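/- Let $(\mathcal H,[\cdot,\cdot])$ be a Krein space, i.e. a complex vector space with a hermitian sesquilinear form admitting a fundamental decomposition: a $[\cdot,\cdot]$-orthogonal direct sum $\mathcal H=\mathcal H_+\dotplus\mathcal H_-$ such that $(\mathcal H_+,[\cdot,\cdot])$ and $(\mathcal H_-,-[\cdot,\cdot])$ are Hilbert spaces. Its topology is the norm topology of the Hilbert space inner product $(x_++x_-,\,y_++y_-)\mapsto[x_+,y_+]-[x_-,y_-]$, and $\|\cdot\|$ denotes any norm inducing this topology. For a bounded operator $T$ on $\mathcal H$ let $T^+$ be its adjoint with respect to $[\cdot,\cdot]$, $\operatorname{Re}T=\frac12(T+T^+)$ and $\operatorname{Im}T=\frac1{2i}(T-T^+)$. Call a Hilbert space scalar product on $\mathcal H$ admissible if it induces the topology of $\mathcal H$. **Theorem.** Let $N$ be a bounded operator on $\mathcal H$ that is normal in the Krein space, i.e. $N^+N=NN^+$. Assume that $N$ is similar to a normal operator in a Hilbert space, i.e. $N$ is normal with respect to some admissible scalar product, and that $\sigma(\operatorname{Re}N)\subset\mathbb R$ and $\sigma(\operatorname{Im}N)\subset\mathbb R$. Then $\operatorname{Re}N$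 and $\operatorname{Im}N$ are similar to selfadjoint operators in a Hilbert space, i.e. there is an admissible scalar product with respect to which both are selfadjoint. In particular, the growth of their resolvents is of first order: for $T=\operatorname{Re}N$ and for $T=\operatorname{Im}N$ there are $c>0$ and $M>0$ such that $$0<|\operatorname{Im}\lambda|<c\quad\Longrightarrow\quad\|(T-\lambda)^{-1}\|\le\frac{M}{|\operatorname{Im}\lambda|}.$$ -/

import Mathlib

open Filter Topology

noncomputable section

namespace Krein

/-- `B` restricted to the subspace `K` is a Hilbert space inner product: it is positive definite
on `K`, and every sequence in `K` that is Cauchy for the norm `x ↦ (B x x)^(1/2)` converges in `K`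
for that norm. (Hermitian symmetry of `B` is required separately.) -/
structure IsHilbertOn {V : Type*} [AddCommGroup V] [Module ℂ V]
    (B : V →ₗ⋆[ℂ] V →ₗ[ℂ] ℂ) (K : Submodule ℂ V) : Prop where
  pos : ∀ x ∈ K, x ≠ 0 → 0 < (B x x).re
  complete : ∀ u : ℕ → V, (∀ n, u n ∈ K) →
    (∀ ε : ℝ, 0 < ε → ∃ n₀, ∀ m ≥ n₀, ∀ n ≥ n₀, (B (u m - u n) (u m - u n)).re < ε) →
    ∃ x ∈ K, Tendsto (fun n => (B (u n - x) (u n - x)).re) atTop (𝓝 0)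

/-- `Hp [+] Hm` is a fundamental decomposition for the hermitian form `B`: a direct sum,
orthogonal with respect to `B`, such that `(Hp, B)` and `(Hm, -B)` are Hilbert spaces. -/
structure IsFundamentalDecomposition {V : Type*} [AddCommGroup V] [Module ℂ V]
    (B : V →ₗ⋆[ℂ] V →ₗ[ℂ] ℂ) (Hp Hm : Submodule ℂ V) : Prop where
  isCompl : IsCompl Hp Hm
  orthogonal : ∀ x ∈ Hp, ∀ y ∈ Hm, B x y = 0
  hilbert_pos : IsHilbertOn B Hp
  hilbert_neg : IsHilbertOn (-B) Hm

variable {H : Type*} [NormedAddCommGroup H] [NormedSpace ℂ H]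

/-- `(H, B)` is a Krein space, and the norm of `H` induces the topology of that Krein space.
The topology of a Krein space is that of the Hilbert space inner product
`(x₊ + x₋, y₊ + y₋) ↦ B x₊ y₊ - B x₋ y₋` of a fundamental decomposition; a norm induces it
if and only if it is equivalent to the norm of that inner product. -/
structure IsKreinSpace (B : H →ₗ⋆[ℂ] H →ₗ[ℂ] ℂ) : Prop where
  symm : B.IsSymm
  exists_decomposition : ∃ Hp Hm : Submodule ℂ H, IsFundamentalDecomposition B Hp Hm ∧
    ∃ c C : ℝ, 0 < c ∧ 0 < C ∧ ∀ x ∈ Hp, ∀ y ∈ Hm,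
      c * ‖x + y‖ ^ 2 ≤ (B x x).re - (B y y).re ∧
      (B x x).re - (B y y).re ≤ C * ‖x + y‖ ^ 2

/-- `S` is a Hilbert space scalar product on `H` which induces the topology of `H`. -/
structure IsHilbertScalarProduct (S : H →ₗ⋆[ℂ] H →ₗ[ℂ] ℂ) : Prop where
  symm : S.IsSymm
  hilbert : IsHilbertOn S ⊤
  induces_topology : ∃ c C : ℝ, 0 < c ∧ 0 < C ∧
    ∀ x, c * ‖x‖ ^ 2 ≤ (S x x).re ∧ (S x x).re ≤ C * ‖x‖ ^ 2

/-- `T'` is an adjoint of `T` with respect to the form `B`. -/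
def IsAdjoint (B : H →ₗ⋆[ℂ] H →ₗ[ℂ] ℂ) (T T' : H →L[ℂ] H) : Prop :=
  ∀ x y, B (T x) y = B x (T' y)

/-- Selfadjointness of a bounded operator with respect to the form `B`. -/
def IsSelfadjointWrt (B : H →ₗ⋆[ℂ] H →ₗ[ℂ] ℂ) (T : H →L[ℂ] H) : Prop :=
  IsAdjoint B T T

/-- `T` commutes with its adjoint with respect to the form `B`. -/
def IsNormalWrt (B : H →ₗ⋆[ℂ] H →ₗ[ℂ] ℂ) (T : H →L[ℂ] H) : Prop :=
  ∃ T' : H →L[ℂ] H, IsAdjoint B T T' ∧ T' * T = T * T'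

/-- `T` is similar to a normal operator in a Hilbert space. -/
def IsSimilarToNormal (T : H →L[ℂ] H) : Prop :=
  ∃ S : H →ₗ⋆[ℂ] H →ₗ[ℂ] ℂ, IsHilbertScalarProduct S ∧ IsNormalWrt S T

/-- The operator `T` has real spectrum. -/
def HasRealSpectrum (T : H →L[ℂ] H) : Prop :=
  ∀ z ∈ spectrum ℂ T, z.im = 0

/-- The spectrum of `T` is real and the growth of the resolvent of `T` is of finite order `n`:
`‖(T - z)⁻¹‖ ≤ M / |Im z| ^ n` for `0 < |Im z| < c`. Here `resolvent T z = (z - T)⁻¹`, which has the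
same norm. -/
def HasResolventGrowth (T : H →L[ℂ] H) (n : ℕ) : Prop :=
  n ≠ 0 ∧ HasRealSpectrum T ∧
    ∃ c : ℝ, 0 < c ∧ ∃ M : ℝ, 0 < M ∧
      ∀ z : ℂ, 0 < |z.im| → |z.im| < c → ‖resolvent T z‖ ≤ M / |z.im| ^ n

/-! ### The adjoint of a bounded operator in a Krein space -/

lemma nonneg_of_pos {V : Type*} [AddCommGroup V] [Module ℂ V]
    {S : V →ₗ⋆[ℂ] V →ₗ[ℂ] ℂ} {K : Submodule ℂ V} (h : IsHilbertOn S K) {x : V} (hx : x ∈ K) :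
    0 ≤ (S x x).re := by
  by_cases h0 : x = 0
  · simp [h0]
  · exact (h.pos x hx h0).le

/-- The Cauchy-Schwarz inequality and the Riesz representation theorem for a Hilbert space
inner product given as a sesquilinear form. -/
lemma schwarz_and_riesz {V : Type*} [AddCommGroup V] [Module ℂ V]
    (S : V →ₗ⋆[ℂ] V →ₗ[ℂ] ℂ) (hs : S.IsSymm) (hS : IsHilbertOn S ⊤) :
    (∀ x y, ‖S x y‖ ≤ √(S x x).re * √(S y y).re) ∧
    ∀ (f : V →ₗ[ℂ] ℂ) (C : ℝ), (∀ x, ‖f x‖ ≤ C * √(S x x).re) → ∃ v, ∀ x, f x = S v x := by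
  let core : InnerProductSpace.Core ℂ V :=
    { inner := fun x y => S x y
      conj_inner_symm := fun x y => hs.eq y x
      re_inner_nonneg := fun x => nonneg_of_pos hS (Submodule.mem_top)
      add_left := fun x y z => by simp
      smul_left := fun x y r => by simp
      definite := fun x hx => by
        by_contra h
        have := hS.pos x Submodule.mem_top h
        have hx' : S x x = 0 := hx
        simp [hx'] at this }
  let : NormedAddCommGroup V := core.toNormedAddCommGroup
  let : InnerProductSpace ℂ V := InnerProductSpace.ofCore core.toCore
  have hnorm : ∀ x : V, ‖x‖ = √(S x x).re := fun x => rfl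
  have hin : ∀ x y : V, inner ℂ x y = S x y := fun x y => rfl
  have hsq : ∀ x : V, (S x x).re = ‖x‖ ^ 2 := fun x => by
    rw [hnorm, Real.sq_sqrt (nonneg_of_pos hS Submodule.mem_top)]
  refine ⟨fun x y => ?_, fun f C hf => ?_⟩
  · rw [← hnorm, ← hnorm, ← hin]
    exact norm_inner_le_norm x y
  · have : CompleteSpace V := by
      refine Metric.complete_of_cauchySeq_tendsto fun u hu => ?_
      obtain ⟨x, -, hx⟩ := hS.complete u (fun _ => Submodule.mem_top) (fun ε hε => by
        obtain ⟨n₀, hn₀⟩ := Metric.cauchySeq_iff.1 hu (√ε) (Real.sqrt_pos.2 hε)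
        refine ⟨n₀, fun m hm n hn => ?_⟩
        have := hn₀ m hm n hn
        rw [dist_eq_norm] at this
        rw [hsq]
        calc ‖u m - u n‖ ^ 2 < √ε ^ 2 := by gcongr
          _ = ε := Real.sq_sqrt hε.le)
      refine ⟨x, tendsto_iff_norm_sub_tendsto_zero.2 ?_⟩
      have := hx.sqrt
      simpa [hnorm] using this
    let F : StrongDual ℂ V := f.mkContinuous C (fun x => by rw [hnorm]; exact hf x)
    refine ⟨(InnerProductSpace.toDual ℂ V).symm F, fun x => ?_⟩
    rw [← hin, InnerProductSpace.toDual_symm_apply]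
    rfl

/-- A Krein space carries a bounded involution `J` (a fundamental symmetry) for which `B (J x) y`
is a Hilbert space scalar product inducing the topology. -/
lemma IsKreinSpace.exists_symmetry {B : H →ₗ⋆[ℂ] H →ₗ[ℂ] ℂ} (hB : IsKreinSpace B) :
    ∃ J : H →ₗ[ℂ] H, (∀ x, J (J x) = x) ∧ (∀ x y, B (J x) y = B x (J y)) ∧
      IsHilbertScalarProduct (B.comp J) := by
  obtain ⟨Hp, Hm, hd, c, C, hc, hC, hcC⟩ := hB.exists_decomposition
  set P := Hp.projection Hm hd.isCompl with hP
  set Q := Hm.projection Hp hd.isCompl.symm with hQ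
  have hPm : ∀ x, P x ∈ Hp := fun x => Submodule.projection_apply_mem _ x
  have hQm : ∀ x, Q x ∈ Hm := fun x => Submodule.projection_apply_mem _ x
  have hPQ : ∀ x, P x + Q x = x := fun x => Submodule.projection_add_projection_eq_self hd.isCompl x
  have hPp : ∀ x ∈ Hp, P x = x := fun x hx => Submodule.projection_apply_left hd.isCompl ⟨x, hx⟩
  have hQq : ∀ x ∈ Hm, Q x = x :=
    fun x hx => Submodule.projection_apply_left hd.isCompl.symm ⟨x, hx⟩
  have hPq : ∀ x ∈ Hm, P x = 0 := fun x hx => by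
    have := hPQ x
    rw [hQq x hx] at this
    simpa using this
  have hQp : ∀ x ∈ Hp, Q x = 0 := fun x hx => by
    have := hPQ x
    rw [hPp x hx] at this
    simpa using this
  have o1 : ∀ x y, B (P x) (Q y) = 0 := fun x y => hd.orthogonal _ (hPm x) _ (hQm y)
  have o2 : ∀ x y, B (Q x) (P y) = 0 := fun x y => by
    rw [← hB.symm.eq, o1, map_zero]
  have e1 : ∀ x y, B x y = B (P x) (P y) + B (Q x) (Q y) := fun x y => by
    conv_lhs => rw [← hPQ x, ← hPQ y]
    simp [o1, o2]
  have PP : ∀ x, P (P x) = P x := fun x => hPp _ (hPm x)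
  have QQ : ∀ x, Q (Q x) = Q x := fun x => hQq _ (hQm x)
  have PQ0 : ∀ x, P (Q x) = 0 := fun x => hPq _ (hQm x)
  have QP0 : ∀ x, Q (P x) = 0 := fun x => hQp _ (hPm x)
  have key : ∀ x y, B ((P - Q) x) y = B (P x) (P y) - B (Q x) (Q y) := fun x y => by
    rw [e1]
    simp [PP, QQ, PQ0, QP0, sub_eq_add_neg]
  have kre : ∀ x, (B ((P - Q) x) x).re = (B (P x) (P x)).re - (B (Q x) (Q x)).re := fun x => by
    rw [key, Complex.sub_re]
  have hp0 : ∀ x, 0 ≤ (B (P x) (P x)).re := fun x => nonneg_of_pos hd.hilbert_pos (hPm x)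
  have hq0 : ∀ x, (B (Q x) (Q x)).re ≤ 0 := fun x => by
    have := nonneg_of_pos hd.hilbert_neg (hQm x)
    simpa using this
  have hbd : ∀ x, c * ‖x‖ ^ 2 ≤ (B ((P - Q) x) x).re ∧ (B ((P - Q) x) x).re ≤ C * ‖x‖ ^ 2 := by
    intro x
    have := hcC (P x) (hPm x) (Q x) (hQm x)
    rwa [hPQ, ← kre] at this
  refine ⟨P - Q, fun x => ?_, fun x y => ?_, ⟨⟨fun x y => ?_⟩, ⟨fun x _ hx => ?_, ?_⟩, c, C, hc, hC, hbd⟩⟩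
  · simp [PP, QQ, PQ0, QP0, hPQ]
  · rw [key, e1 x]
    simp [PP, QQ, PQ0, QP0, sub_eq_add_neg]
  · change (starRingEnd ℂ) (B ((P - Q) x) y) = B ((P - Q) y) x
    rw [key, key, map_sub, hB.symm.eq, hB.symm.eq]
  · change 0 < (B ((P - Q) x) x).re
    have : 0 < ‖x‖ := norm_pos_iff.2 hx
    have := (hbd x).1
    have : 0 < c * ‖x‖ ^ 2 := by positivity
    linarith
  · intro u _ hu
    obtain ⟨a, ha, ha'⟩ := hd.hilbert_pos.complete (fun n => P (u n)) (fun n => hPm _)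
      (fun ε hε => by
        obtain ⟨n₀, h⟩ := hu ε hε
        refine ⟨n₀, fun m hm n hn => ?_⟩
        have h1 : (B ((P - Q) (u m - u n)) (u m - u n)).re < ε := h m hm n hn
        rw [kre] at h1
        have h2 := hq0 (u m - u n)
        rw [← map_sub]
        linarith)
    obtain ⟨b, hb, hb'⟩ := hd.hilbert_neg.complete (fun n => Q (u n)) (fun n => hQm _)
      (fun ε hε => by
        obtain ⟨n₀, h⟩ := hu ε hε
        refine ⟨n₀, fun m hm n hn => ?_⟩
        have h1 : (B ((P - Q) (u m - u n)) (u m - u n)).re < ε := h m hm n hn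
        rw [kre] at h1
        have h2 := hp0 (u m - u n)
        rw [← map_sub, LinearMap.neg_apply, LinearMap.neg_apply, Complex.neg_re]
        linarith)
    refine ⟨a + b, Submodule.mem_top, ?_⟩
    have hsum := ha'.add hb'
    rw [add_zero] at hsum
    refine hsum.congr fun n => ?_
    change _ = (B ((P - Q) (u n - (a + b))) (u n - (a + b))).re
    have hPa : P (u n - (a + b)) = P (u n) - a := by simp [hPp a ha, hPq b hb]
    have hQb : Q (u n - (a + b)) = Q (u n) - b := by simp [hQp a ha, hQq b hb]
    rw [kre, hPa, hQb, LinearMap.neg_apply, LinearMap.neg_apply, Complex.neg_re]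
    ring

/-- Every bounded operator in a Krein space has exactly one adjoint. -/
lemma IsKreinSpace.existsUnique_adjoint {B : H →ₗ⋆[ℂ] H →ₗ[ℂ] ℂ} (hB : IsKreinSpace B)
    (T : H →L[ℂ] H) : ∃! T' : H →L[ℂ] H, IsAdjoint B T T' := by
  obtain ⟨J, hJJ, hJ, hS⟩ := hB.exists_symmetry
  obtain ⟨hcs, hriesz⟩ := schwarz_and_riesz _ hS.symm hS.hilbert
  obtain ⟨c, C, hc, hC, hbd⟩ := hS.induces_topology
  have hSB : ∀ x y, (B.comp J) x y = B (J x) y := fun x y => rfl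
  have hBS : ∀ x y, B x y = (B.comp J) (J x) y := fun x y => by rw [hSB, hJJ]
  have hSJ : ∀ x, (B.comp J) (J x) (J x) = (B.comp J) x x := fun x => by
    rw [hSB, hSB, hJJ, ← hJ]
  have hup : ∀ x, √((B.comp J) x x).re ≤ √C * ‖x‖ := fun x => by
    calc √((B.comp J) x x).re ≤ √(C * ‖x‖ ^ 2) := Real.sqrt_le_sqrt (hbd x).2
      _ = √C * ‖x‖ := by rw [Real.sqrt_mul hC.le, Real.sqrt_sq (norm_nonneg x)]
  have hlow : ∀ x, √c * ‖x‖ ≤ √((B.comp J) x x).re := fun x => by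
    calc √c * ‖x‖ = √(c * ‖x‖ ^ 2) := by rw [Real.sqrt_mul hc.le, Real.sqrt_sq (norm_nonneg x)]
      _ ≤ _ := Real.sqrt_le_sqrt (hbd x).1
  have hc' : 0 < √c := Real.sqrt_pos.2 hc
  have hBle : ∀ x y, ‖B x y‖ ≤ √((B.comp J) x x).re * √((B.comp J) y y).re := fun x y => by
    rw [hBS]
    refine (hcs _ _).trans_eq ?_
    rw [hSJ]
  have nondeg : ∀ x y, (∀ z, B z x = B z y) → x = y := fun x y h => by
    by_contra hne
    have h1 := hS.hilbert.pos (x - y) Submodule.mem_top (sub_ne_zero.2 hne)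
    rw [hSB, map_sub (B (J (x - y))), h, sub_self] at h1
    simp at h1
  have hTb : ∀ x, √((B.comp J) (T x) (T x)).re ≤ (√C * ‖T‖ / √c) * √((B.comp J) x x).re :=
    fun x => by
      calc _ ≤ √C * ‖T x‖ := hup _
        _ ≤ √C * (‖T‖ * ‖x‖) := by gcongr; exact T.le_opNorm x
        _ = (√C * ‖T‖ / √c) * (√c * ‖x‖) := by field_simp
        _ ≤ _ := by gcongr; exact hlow x
  have hex : ∀ y, ∃ w, ∀ x, B (T x) y = B x w := by
    intro y
    obtain ⟨v, hv⟩ := hriesz ((B y).comp (T : H →ₗ[ℂ] H))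
      (√((B.comp J) y y).re * (√C * ‖T‖ / √c)) (fun x => by
        calc ‖B y (T x)‖ ≤ _ := hBle _ _
          _ ≤ √((B.comp J) y y).re * ((√C * ‖T‖ / √c) * √((B.comp J) x x).re) := by
              gcongr; exact hTb x
          _ = _ := by ring)
    refine ⟨J v, fun x => ?_⟩
    have h1 : B y (T x) = B (J v) x := hv x
    rw [← hB.symm.eq, h1, hB.symm.eq]
  choose W hW using hex
  let L : H →ₗ[ℂ] H :=
    { toFun := W
      map_add' := fun x y => nondeg _ _ fun z => by rw [← hW, map_add, map_add, hW, hW]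
      map_smul' := fun r x => nondeg _ _ fun z => by
        rw [← hW, map_smul, map_smul, hW]; rfl }
  have hL : ∀ y, ‖L y‖ ≤ ((√C * ‖T‖ / √c) * √C / √c) * ‖y‖ := by
    intro y
    set s := √((B.comp J) (L y) (L y)).re with hs
    have hs0 : 0 ≤ s := Real.sqrt_nonneg _
    have h1 : s * s ≤ s * ((√C * ‖T‖ / √c) * (√C * ‖y‖)) := by
      calc s * s = ((B.comp J) (L y) (L y)).re :=
            Real.mul_self_sqrt (nonneg_of_pos hS.hilbert Submodule.mem_top)
        _ ≤ ‖(B.comp J) (L y) (L y)‖ := Complex.re_le_norm _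
        _ = ‖B (T (J (L y))) y‖ := by rw [hW]; rfl
        _ ≤ _ := hBle _ _
        _ ≤ ((√C * ‖T‖ / √c) * √((B.comp J) (J (L y)) (J (L y))).re) * (√C * ‖y‖) := by
            gcongr
            · exact hTb _
            · exact hup _
        _ = _ := by rw [hSJ]; ring
    have h2 : s ≤ (√C * ‖T‖ / √c) * (√C * ‖y‖) := by
      rcases hs0.eq_or_lt with h | h
      · rw [← h]; positivity
      · exact le_of_mul_le_mul_left h1 h
    have h3 := (hlow (L y)).trans h2
    calc ‖L y‖ = (√c * ‖L y‖) / √c := by field_simp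
      _ ≤ ((√C * ‖T‖ / √c) * (√C * ‖y‖)) / √c := by gcongr
      _ = _ := by ring
  refine ⟨L.mkContinuous _ hL, fun x y => hW y x, fun T' hT' => ?_⟩
  ext y
  exact nondeg _ _ fun z => (hT' z y).symm.trans (hW y z)

/-- The adjoint `T⁺` of the bounded operator `T` in the Krein space `(H, B)`, that is, the
operator with `B (T x) y = B x (T⁺ y)` for all `x` and `y`. -/
def adjoint {B : H →ₗ⋆[ℂ] H →ₗ[ℂ] ℂ} (hB : IsKreinSpace B) (T : H →L[ℂ] H) : H →L[ℂ] H :=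
  (hB.existsUnique_adjoint T).choose

lemma isAdjoint_adjoint {B : H →ₗ⋆[ℂ] H →ₗ[ℂ] ℂ} (hB : IsKreinSpace B) (T : H →L[ℂ] H) :
    IsAdjoint B T (adjoint hB T) :=
  (hB.existsUnique_adjoint T).choose_spec.1

/-- The real part `(T + T⁺) / 2` of a bounded operator in a Krein space. -/
def realPart {B : H →ₗ⋆[ℂ] H →ₗ[ℂ] ℂ} (hB : IsKreinSpace B) (T : H →L[ℂ] H) : H →L[ℂ] H :=
  (1 / 2 : ℂ) • (T + adjoint hB T)

/-- The imaginary part `(T - T⁺) / 2i` of a bounded operator in a Krein space. -/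
def imagPart {B : H →ₗ⋆[ℂ] H →ₗ[ℂ] ℂ} (hB : IsKreinSpace B) (T : H →L[ℂ] H) : H →L[ℂ] H :=
  (1 / (2 * Complex.I) : ℂ) • (T - adjoint hB T)

/-- Normality of a bounded operator in a Krein space: `T⁺ T = T T⁺`. -/
def IsKreinNormal {B : H →ₗ⋆[ℂ] H →ₗ[ℂ] ℂ} (hB : IsKreinSpace B) (T : H →L[ℂ] H) : Prop :=
  adjoint hB T * T = T * adjoint hB T

end Krein

end

/-!
The form of the Krein space is written as `B x y = S (g x) y`, where `S` is an admissible scalar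
product for which `N` is normal and the Gram operator `g` is invertible and `S`-selfadjoint. If `N⋆`
denotes the `S`-adjoint, then the Krein space adjoint is `N⁺ = g⁻¹ N⋆ g`, and the point is that the
hypotheses force `N⁺ = N⋆`. The real and imaginary parts in the Krein space are then those for `S`,
so they are selfadjoint for the very same `S`, and the resolvent estimate is the usual one for
selfadjoint operators.

To see that `N⁺ = N⋆`, note that by Fuglede's theorem `N`, `N⋆`, `N⁺ = g⁻¹ N⋆ g` and `g⁻¹ N g`
commute pairwise. The difference `N⁺ - N⋆` is twice the difference of the two real parts and `2i`
times the difference of the two imaginary parts, all of which have real spectrum; since spectra of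
commuting elements are subadditive (`Commute.exists_add_of_mem_spectrum_add`), `N⁺ - N⋆` has real
and imaginary spectrum, so it is quasinilpotent. So is `g⁻¹ N g - N`, which is minus the Krein space
adjoint of `N⁺ - N⋆`. Hence for `h = N⋆ + N` and for `h = i (N⋆ - N)`, the selfadjoint element `h`
commutes with `g⁻¹ h g` and differs from it by a quasinilpotent element `a`. The group
`exp (i x a) = g⁻¹ exp (i x h) g exp (-i x h)` is bounded, because `exp (i x h)` is unitary, while
`exp (z a)` has exponential type zero. By Phragmén–Lindelöf and Liouville, `a = 0`
(`eq_zero_of_spectrum_subset_zero_of_bounded_exp`). Thus `g⁻¹ h g = h` for both choices of `h`,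
which gives `g⁻¹ N⋆ g = N⋆`.
-/

/-! ### Quasinilpotent generators of bounded groups -/

open Asymptotics Bornology in
/-- If the spectrum of `a` is contained in `{0}`, then the powers of `a` decay faster than every
geometric sequence, so that `z ↦ exp (z • a)` is of exponential type zero. -/
theorem norm_exp_smul_le_of_spectrum_subset_zero {A : Type*} [NormedRing A] [NormedAlgebra ℂ A]
    [CompleteSpace A] {a : A} (ha : spectrum ℂ a ⊆ {0}) {ε : ℝ} (hε : 0 < ε) :
    ∃ C : ℝ, 0 ≤ C ∧ ∀ z : ℂ, ‖NormedSpace.exp (z • a)‖ ≤ C * Real.exp (ε * ‖z‖) := by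
  have hr : spectralRadius ℂ a = 0 := by
    refine le_antisymm (iSup₂_le fun k hk => ?_) bot_le
    have : k = 0 := ha hk
    simp [this]
  have hO : (fun n : ℕ => ‖a ^ n‖) =O[atTop] fun n : ℕ => ε ^ n := by
    have h := spectrum.pow_norm_pow_one_div_tendsto_nhds_spectralRadius a
    rw [hr] at h
    have h1 := (h.eventually (gt_mem_nhds (ENNReal.ofReal_pos.2 hε))).and (eventually_gt_atTop 0)
    refine IsBigO.of_bound 1 (h1.mono fun n hn => ?_)
    have h2 : ‖a ^ n‖ ^ (1 / n : ℝ) < ε := (ENNReal.ofReal_lt_ofReal_iff hε).1 hn.1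
    have h3 : (‖a ^ n‖ ^ (1 / n : ℝ)) ^ n = ‖a ^ n‖ := by
      rw [one_div, Real.rpow_inv_natCast_pow (norm_nonneg _) hn.2.ne']
    rw [one_mul, norm_norm, Real.norm_of_nonneg (by positivity), ← h3]
    exact pow_le_pow_left₀ (by positivity) h2.le n
  obtain ⟨C, hC, hCb⟩ := bound_of_isBigO_nat_atTop hO
  have hb : ∀ n, ‖a ^ n‖ ≤ C * ε ^ n := fun n => by
    have := hCb (x := n) (by positivity)
    rwa [norm_norm, Real.norm_of_nonneg (by positivity)] at this
  refine ⟨C, hC.le, fun z => ?_⟩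
  have hs : HasSum (fun n : ℕ => C * ((ε * ‖z‖) ^ n / n.factorial))
      (C * Real.exp (ε * ‖z‖)) := by
    have := (NormedSpace.expSeries_div_hasSum_exp (ε * ‖z‖)).mul_left C
    rwa [← Real.exp_eq_exp_ℝ] at this
  refine (NormedSpace.exp_series_hasSum_exp' (𝕂 := ℂ) (z • a)).norm_le_of_bounded hs fun n => ?_
  rw [smul_pow, norm_smul, norm_smul, norm_pow, norm_inv, Complex.norm_natCast]
  calc _ ≤ (n.factorial : ℝ)⁻¹ * (‖z‖ ^ n * (C * ε ^ n)) := by gcongr; exact hb n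
    _ = _ := by rw [mul_pow]; ring

open Asymptotics Bornology in
/-- Phragmén–Lindelöf step: since `exp (z • a)` has exponential type zero, a bound on the
imaginary axis persists in the right half-plane. -/
theorem norm_exp_smul_le_of_re_nonneg {A : Type*} [NormedRing A] [NormedAlgebra ℂ A]
    [CompleteSpace A] {a : A} (ha : spectrum ℂ a ⊆ {0}) {K : ℝ}
    (hK : ∀ x : ℝ, ‖NormedSpace.exp ((x * Complex.I) • a)‖ ≤ K) {z : ℂ} (hz : 0 ≤ z.re) :
    ‖NormedSpace.exp (z • a)‖ ≤ K := by
  have hd : Differentiable ℂ fun w : ℂ => NormedSpace.exp (w • a) := fun w =>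
    (hasDerivAt_exp_smul_const a w).differentiableAt
  have key : ∀ ε : ℝ, 0 < ε → Real.exp (-(ε * z.re)) * ‖NormedSpace.exp (z • a)‖ ≤ K := by
    intro ε hε
    obtain ⟨C, hC, hb⟩ := norm_exp_smul_le_of_spectrum_subset_zero ha hε
    set f : ℂ → A := fun w => Complex.exp (-(ε * w)) • NormedSpace.exp (w • a) with hf
    have hn : ∀ w, ‖f w‖ = Real.exp (-(ε * w.re)) * ‖NormedSpace.exp (w • a)‖ := fun w => by
      rw [hf, norm_smul, Complex.norm_exp]
      simp
    have he : Differentiable ℂ fun w : ℂ => Complex.exp (-(ε * w)) := by fun_prop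
    have hfd : Differentiable ℂ f := he.smul hd
    rw [← hn]
    refine PhragmenLindelof.right_half_plane_of_bounded_on_real hfd.diffContOnCl
      ⟨1, by norm_num, ε, IsBigO.of_bound C ?_⟩ ⟨C, ?_⟩ (fun x => ?_) hz
    · refine (eventually_inf_principal.2 (Eventually.of_forall fun w (hw : 0 < w.re) => ?_))
      rw [hn, Real.rpow_one, Real.norm_of_nonneg (Real.exp_pos _).le]
      have h1 : Real.exp (-(ε * w.re)) ≤ 1 := Real.exp_le_one_iff.2 (by nlinarith)
      calc _ ≤ 1 * ‖NormedSpace.exp (w • a)‖ := by gcongr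
        _ ≤ _ := by rw [one_mul]; exact hb w
    · refine eventually_map.2 ((eventually_ge_atTop 0).mono fun x hx => ?_)
      rw [hn]
      calc _ ≤ Real.exp (-(ε * x)) * (C * Real.exp (ε * ‖(x : ℂ)‖)) := by
            rw [Complex.ofReal_re]; gcongr; exact hb x
        _ = C * (Real.exp (-(ε * x)) * Real.exp (ε * x)) := by
            rw [Complex.norm_of_nonneg hx]; ring
        _ = C := by rw [← Real.exp_add]; simp
    · rw [hn]
      simpa using hK x
  have hlim : Tendsto (fun ε : ℝ => Real.exp (-(ε * z.re)) * ‖NormedSpace.exp (z • a)‖)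
      (𝓝[>] 0) (𝓝 (Real.exp (-(0 * z.re)) * ‖NormedSpace.exp (z • a)‖)) := by
    refine Tendsto.mono_left (Continuous.tendsto ?_ 0) nhdsWithin_le_nhds
    fun_prop
  rw [zero_mul, neg_zero, Real.exp_zero, one_mul] at hlim
  exact le_of_tendsto hlim (eventually_mem_nhdsWithin.mono fun ε hε => key ε hε)

/-- An element with spectrum in `{0}` that generates a bounded one-parameter group vanishes
(a theorem of Gelfand and Hille). -/
theorem eq_zero_of_spectrum_subset_zero_of_bounded_exp {A : Type*} [NormedRing A]
    [NormedAlgebra ℂ A] [CompleteSpace A] {a : A} (ha : spectrum ℂ a ⊆ {0}) {K : ℝ}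
    (hK : ∀ x : ℝ, ‖NormedSpace.exp ((x * Complex.I) • a)‖ ≤ K) : a = 0 := by
  have hneg : spectrum ℂ (-a) ⊆ {0} := by
    rw [← spectrum.neg_eq]
    intro z hz
    simpa using ha hz
  have hKneg : ∀ x : ℝ, ‖NormedSpace.exp ((x * Complex.I) • (-a))‖ ≤ K := fun x => by
    have := hK (-x)
    rwa [Complex.ofReal_neg, neg_mul, neg_smul, ← smul_neg] at this
  have hbd : ∀ z : ℂ, ‖NormedSpace.exp (z • a)‖ ≤ K := fun z => by
    rcases le_total 0 z.re with hz | hz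
    · exact norm_exp_smul_le_of_re_nonneg ha hK hz
    · have := norm_exp_smul_le_of_re_nonneg hneg hKneg (z := -z) (by simpa using hz)
      rwa [smul_neg, neg_smul, neg_neg] at this
  have hd : ∀ w : ℂ, HasDerivAt (fun w : ℂ => NormedSpace.exp (w • a))
      (NormedSpace.exp (w • a) * a) w := fun w => hasDerivAt_exp_smul_const a w
  have hconst : (fun w : ℂ => NormedSpace.exp (w • a)) = fun _ => NormedSpace.exp ((0 : ℂ) • a) :=
    funext fun w => Differentiable.apply_eq_apply_of_bounded
      (fun w => (hd w).differentiableAt)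
      (isBounded_iff_forall_norm_le.2 ⟨K, by rintro _ ⟨z, rfl⟩; exact hbd z⟩) w 0
  have h0 := hd 0
  rw [hconst] at h0
  simpa using h0.unique (hasDerivAt_const (0 : ℂ) _)

/-! ### Spectra of commuting elements -/

/-- Additivity of spectra up to inclusion, through the characters of the commutative Banach algebra
given by the double commutant of `a` and `b`. -/
theorem Commute.exists_add_of_mem_spectrum_add {A : Type*} [NormedRing A] [NormedAlgebra ℂ A]
    [CompleteSpace A] {a b : A} (h : Commute a b) {z : ℂ} (hz : z ∈ spectrum ℂ (a + b)) :
    ∃ x ∈ spectrum ℂ a, ∃ y ∈ spectrum ℂ b, x + y = z := by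
  set D : Subalgebra ℂ A := Subalgebra.centralizer ℂ (Set.centralizer {a, b}) with hD
  have hmem : ∀ x, x ∈ D ↔ x ∈ Set.centralizer (Set.centralizer {a, b}) := fun x => Iff.rfl
  have hcomm : ∀ x y : D, x * y = y * x := fun x y => Subtype.ext <|
    Set.centralizer_centralizer_comm_of_comm (S := {a, b}) (by
      rintro x (rfl | rfl) y (rfl | rfl)
      exacts [rfl, h.eq, h.eq.symm, rfl]) _ x.2 _ y.2
  let : NormedCommRing D := { (inferInstance : NormedRing D) with mul_comm := hcomm }
  have : CompleteSpace D := (Set.isClosed_centralizer _).completeSpace_coe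
  -- The double commutant is closed under inversion, so it does not enlarge spectra.
  have hspec : ∀ (x : D) (w : ℂ), w ∈ spectrum ℂ x → w ∈ spectrum ℂ (x : A) := by
    intro x w hw hu
    refine hw ?_
    obtain ⟨u, hu⟩ := (show IsUnit (algebraMap ℂ A w - x) from hu)
    have huD : (u : A) ∈ Set.centralizer (Set.centralizer {a, b}) := by
      rw [hu]; exact (algebraMap ℂ D w - x).2
    have huD' : ((u⁻¹ : Aˣ) : A) ∈ D := (hmem _).2 fun c hc =>
      (Commute.units_inv_right (huD c hc : Commute c (u : A))).eq
    refine IsUnit.of_mul_eq_one ⟨_, huD'⟩ (Subtype.ext ?_)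
    change (algebraMap ℂ A w - x) * ((u⁻¹ : Aˣ) : A) = 1
    rw [← hu, Units.mul_inv]
  have hsub := Set.subset_centralizer_centralizer (S := ({a, b} : Set A))
  let a' : D := ⟨a, hsub (by simp)⟩
  let b' : D := ⟨b, hsub (by simp)⟩
  have hz' : z ∈ spectrum ℂ (a' + b') := spectrum.subset_subalgebra (a' + b') hz
  obtain ⟨χ, hχ⟩ := WeakDual.CharacterSpace.mem_spectrum_iff_exists.1 hz'
  exact ⟨χ a', hspec a' _ (WeakDual.CharacterSpace.apply_mem_spectrum χ a'),
    χ b', hspec b' _ (WeakDual.CharacterSpace.apply_mem_spectrum χ b'), by rw [← map_add, hχ]⟩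

theorem spectrum.exists_mul_of_mem_smul {A : Type*} [Ring A] [Algebra ℂ A] {c : ℂ} (hc : c ≠ 0)
    {a : A} {z : ℂ} (hz : z ∈ spectrum ℂ (c • a)) : ∃ w ∈ spectrum ℂ a, z = c * w := by
  have h := spectrum.unit_smul_eq_smul a (Units.mk0 c hc)
  rw [Units.smul_mk0] at h
  rw [h] at hz
  obtain ⟨w, hw, rfl⟩ := hz
  exact ⟨w, hw, rfl⟩

/-! ### Conjugates of normal elements in a C⋆-algebra -/

/-- A selfadjoint element coincides with each of its conjugates that commutes with it and differs from
it by a quasinilpotent element: with `h' = u⁻¹ h u`, the group `exp (i x (h' - h)) = u⁻¹ exp (i x h) u exp (-i x h)` is bounded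
because `exp (i x h)` is unitary. -/
theorem IsSelfAdjoint.conj_eq_of_spectrum_sub_subset_zero {A : Type*} [CStarAlgebra A] {h : A}
    (hh : IsSelfAdjoint h) (u : Aˣ) (hcomm : Commute (↑u⁻¹ * h * u) h)
    (hs : spectrum ℂ (↑u⁻¹ * h * u - h) ⊆ {0}) : ↑u⁻¹ * h * u = h := by
  nontriviality A
  let _ : NormedAlgebra ℚ A := .restrictScalars ℚ ℂ A
  have hunit : ∀ x : ℝ, ‖NormedSpace.exp ((x * Complex.I) • h)‖ = 1 := fun x => by
    refine CStarRing.norm_of_mem_unitary (NormedSpace.exp_mem_unitary_of_mem_skewAdjoint ?_)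
    rw [skewAdjoint.mem_iff, star_smul, hh.star_eq]
    simp
  refine sub_eq_zero.1 (eq_zero_of_spectrum_subset_zero_of_bounded_exp hs
    (K := ‖((u⁻¹ : Aˣ) : A)‖ * ‖(u : A)‖) fun x => ?_)
  have e1 : ((x : ℂ) * Complex.I) • (↑u⁻¹ * h * u - h) =
      ↑u⁻¹ * (((x : ℂ) * Complex.I) • h) * u + (((-x : ℝ) : ℂ) * Complex.I) • h := by
    rw [smul_sub, mul_smul_comm, smul_mul_assoc, sub_eq_add_neg]
    simp
  rw [e1, NormedSpace.exp_add_of_commute, NormedSpace.exp_units_conj']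
  · calc _ ≤ ‖(↑u⁻¹ : A) * NormedSpace.exp (((x : ℂ) * Complex.I) • h) * u‖ *
          ‖NormedSpace.exp ((((-x : ℝ) : ℂ) * Complex.I) • h)‖ := norm_mul_le _ _
      _ ≤ ‖(↑u⁻¹ : A)‖ * ‖NormedSpace.exp (((x : ℂ) * Complex.I) • h)‖ * ‖(u : A)‖ * 1 := by
        rw [hunit (-x)]
        gcongr
        exact norm_mul₃_le
      _ = _ := by rw [hunit x]; ring
  · rw [mul_smul_comm, smul_mul_assoc]
    exact (hcomm.smul_left _).smul_right _

/-- The `u`-adjoint `u⁻¹ n⋆ u` of a normal element `n`, where `u` is selfadjoint and invertible, is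
`n⋆` as soon as it commutes with `n` and `n + u⁻¹ n⋆ u`, `n - u⁻¹ n⋆ u` have real and
imaginary spectrum, as `n + n⋆` and `n - n⋆` do. -/
theorem IsStarNormal.conj_star_eq_star {A : Type*} [CStarAlgebra A] {n : A} (hn : IsStarNormal n)
    (u : Aˣ) (hu : IsSelfAdjoint (u : A)) (hcomm : Commute n (↑u⁻¹ * star n * u))
    (hre : ∀ z ∈ spectrum ℂ (n + ↑u⁻¹ * star n * u), z.im = 0)
    (him : ∀ z ∈ spectrum ℂ (n - ↑u⁻¹ * star n * u), z.re = 0) :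
    ↑u⁻¹ * star n * u = star n := by
  set m : A := ↑u⁻¹ * star n * u with hm
  set k : A := ↑u⁻¹ * n * u with hk
  have hkm : star m = u * n * ↑u⁻¹ := by
    have h1 : star ((u⁻¹ : Aˣ) : A) = ((u⁻¹ : Aˣ) : A) := by
      rw [← Units.coe_star_inv, show star u = u from Units.ext hu.star_eq]
    rw [hm, star_mul, star_mul, star_star, h1, hu.star_eq, mul_assoc]
  have hconj : ∀ x : A, (u : A) * (↑u⁻¹ * x * u) * ↑u⁻¹ = x := fun x => by
    simp [mul_assoc]
  have hconj' : ∀ x : A, ((u⁻¹ : Aˣ) : A) * (↑u * x * ↑u⁻¹) * u = x := fun x => by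
    simp [mul_assoc]
  -- By Fuglede's theorem, `n`, `n⋆`, `m` and `k` commute pairwise.
  have c1 : Commute (star n) m := hn.commute_star_left hcomm
  have c2 : Commute n (star m) := by simpa using c1.star_star
  have hcc : ∀ {x y : A}, Commute x (u * y * ↑u⁻¹) → Commute (↑u⁻¹ * x * u) y := by
    intro x y h
    have : (↑u⁻¹ * x * u) * (↑u⁻¹ * (u * y * ↑u⁻¹) * u) =
        (↑u⁻¹ * (u * y * ↑u⁻¹) * u) * (↑u⁻¹ * x * u) := by
      have e : ∀ x y : A, (↑u⁻¹ * x * u) * (↑u⁻¹ * y * u) = ↑u⁻¹ * (x * y) * u := fun x y => by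
        simp [mul_assoc]
      rw [e, e, h.eq]
    rwa [hconj'] at this
  have c3 : Commute k n := hcc (by rw [← hkm]; exact c2)
  have c4 : Commute k (star n) := hn.commute_star_right c3
  -- `m - n⋆` is a difference of commuting elements with real spectra, and also of commuting
  -- elements with imaginary spectra.
  have hcs : Commute n (star n) := hn.star_comm_self.symm
  have hq : spectrum ℂ (m - star n) ⊆ {0} := by
    intro z hz
    have e1 : m - star n = (n + m) + -(n + star n) := by abel
    have e2 : m - star n = -(n - m) + (n - star n) := by abel
    have hz1 := hz
    rw [e1] at hz1
    obtain ⟨x, hx, y, hy, hxy⟩ := Commute.exists_add_of_mem_spectrum_add (by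
      refine Commute.neg_right (Commute.add_right (Commute.add_left rfl hcomm.symm)
        (Commute.add_left hcs c1.symm))) hz1
    have hz2 := hz
    rw [e2] at hz2
    obtain ⟨x', hx', y', hy', hxy'⟩ := Commute.exists_add_of_mem_spectrum_add (by
      refine Commute.neg_left (Commute.sub_right (Commute.sub_left rfl hcomm.symm)
        (Commute.sub_left hcs c1.symm))) hz2
    have hyim : y.im = 0 := by
      refine IsSelfAdjoint.im_eq_zero_of_mem_spectrum (a := -(n + star n)) ?_ hy
      exact (IsSelfAdjoint.add_star_self n).neg
    have hyre : y'.re = 0 := by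
      have hsa : IsSelfAdjoint (Complex.I • (n - star n)) := by
        rw [IsSelfAdjoint, star_smul, star_sub, star_star]
        simp [← smul_neg]
      have e3 : n - star n = (-Complex.I) • (Complex.I • (n - star n)) := by
        rw [smul_smul]; simp
      rw [e3] at hy'
      obtain ⟨w, hw, rfl⟩ := spectrum.exists_mul_of_mem_smul (by simp) hy'
      simpa using IsSelfAdjoint.im_eq_zero_of_mem_spectrum hsa hw
    have hxre : x'.re = 0 := by
      rw [← spectrum.neg_eq] at hx'
      simpa using him _ hx'
    refine Complex.ext ?_ ?_
    · rw [← hxy', Complex.add_re, hyre, hxre]; simp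
    · rw [← hxy, Complex.add_im, hyim, hre x hx]; simp
  have hq' : spectrum ℂ (k - n) ⊆ {0} := by
    intro z hz
    have e : k - n = -(↑u⁻¹ * star (m - star n) * u) := by
      rw [star_sub, star_star, hkm, mul_sub, sub_mul, hconj', ← hk]
      abel
    rw [e, ← spectrum.neg_eq, Set.mem_neg, spectrum.units_conjugate', spectrum.map_star,
      Set.mem_star] at hz
    simpa using hq hz
  have hsum : ∀ {x y : A}, Commute x y → spectrum ℂ x ⊆ {0} → spectrum ℂ y ⊆ {0} →
      spectrum ℂ (x + y) ⊆ {0} := by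
    intro x y hxy hx hy z hz
    obtain ⟨v, hv, w, hw, rfl⟩ := hxy.exists_add_of_mem_spectrum_add hz
    rw [hx hv, hy hw]; simp
  have ckm : Commute k m := by
    have := congrArg (fun x => ((u⁻¹ : Aˣ) : A) * x * u) hcs.eq
    simpa [hk, hm, mul_assoc, Commute, SemiconjBy] using this
  have cQ : Commute (m - star n) (k - n) :=
    Commute.sub_left (Commute.sub_right ckm.symm hcomm.symm) (Commute.sub_right c4.symm hcs.symm)
  have hRe : m + k = star n + n := by
    have e : ↑u⁻¹ * (star n + n) * u = m + k := by rw [mul_add, add_mul]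
    rw [← e]
    refine (IsSelfAdjoint.star_add_self n).conj_eq_of_spectrum_sub_subset_zero u ?_ ?_
    · rw [e]
      exact Commute.add_left (Commute.add_right c1.symm hcomm.symm) (Commute.add_right c4 c3)
    · rw [e, show m + k - (star n + n) = (m - star n) + (k - n) by abel]
      exact hsum cQ hq hq'
  have hIm : m - k = star n - n := by
    have e : ↑u⁻¹ * (Complex.I • (star n - n)) * u = Complex.I • (m - k) := by
      rw [mul_smul_comm, smul_mul_assoc, mul_sub, sub_mul]
    have hsa : IsSelfAdjoint (Complex.I • (star n - n)) := by
      rw [IsSelfAdjoint, star_smul, star_sub, star_star]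
      simp [← smul_neg]
    refine smul_right_injective A Complex.I_ne_zero (e.symm.trans
      (hsa.conj_eq_of_spectrum_sub_subset_zero u ?_ ?_))
    · rw [e]
      refine Commute.smul_left (Commute.smul_right ?_ _) _
      exact Commute.sub_left (Commute.sub_right c1.symm hcomm.symm) (Commute.sub_right c4 c3)
    · rw [e, ← smul_sub, show m - k - (star n - n) = (m - star n) + -(k - n) by abel]
      intro z hz
      obtain ⟨w, hw, rfl⟩ := spectrum.exists_mul_of_mem_smul Complex.I_ne_zero hz
      rw [hsum cQ.neg_right hq (fun y hy => by
        rw [← spectrum.neg_eq] at hy; simpa using hq' hy) hw]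
      simp
  have h2 : (2 : ℂ) • m = (2 : ℂ) • star n := by
    rw [two_smul, two_smul, show m + m = (m + k) + (m - k) by abel, hRe, hIm]
    abel
  exact smul_right_injective A two_ne_zero h2

/-! ### Hilbert space models and Gram operators -/

universe v

namespace Krein

/-- A space with a Hilbert space inner product given as a form is linearly isomorphic to a
Hilbert space in the sense of Mathlib. -/
lemma IsHilbertOn.exists_model {V : Type v} [AddCommGroup V] [Module ℂ V]
    {S : V →ₗ⋆[ℂ] V →ₗ[ℂ] ℂ} (hs : S.IsSymm) (hS : IsHilbertOn S ⊤) :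
    ∃ (K : Type v) (_ : NormedAddCommGroup K) (_ : InnerProductSpace ℂ K) (_ : CompleteSpace K)
      (e : V ≃ₗ[ℂ] K), ∀ x y, inner ℂ (e x) (e y) = S x y := by
  let core : InnerProductSpace.Core ℂ V :=
    { inner := fun x y => S x y
      conj_inner_symm := fun x y => hs.eq y x
      re_inner_nonneg := fun x => nonneg_of_pos hS (Submodule.mem_top)
      add_left := fun x y z => by simp
      smul_left := fun x y r => by simp
      definite := fun x hx => by
        by_contra h
        have := hS.pos x Submodule.mem_top h
        have hx' : S x x = 0 := hx
        simp [hx'] at this }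
  let i1 : NormedAddCommGroup V := core.toNormedAddCommGroup
  let i2 : InnerProductSpace ℂ V := InnerProductSpace.ofCore core.toCore
  have hnorm : ∀ x : V, ‖x‖ = √(S x x).re := fun x => rfl
  have hsq : ∀ x : V, (S x x).re = ‖x‖ ^ 2 := fun x => by
    rw [hnorm, Real.sq_sqrt (nonneg_of_pos hS Submodule.mem_top)]
  have hc : CompleteSpace V := by
    refine Metric.complete_of_cauchySeq_tendsto fun u hu => ?_
    obtain ⟨x, -, hx⟩ := hS.complete u (fun _ => Submodule.mem_top) (fun ε hε => by
      obtain ⟨n₀, hn₀⟩ := Metric.cauchySeq_iff.1 hu (√ε) (Real.sqrt_pos.2 hε)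
      refine ⟨n₀, fun m hm n hn => ?_⟩
      have := hn₀ m hm n hn
      rw [dist_eq_norm] at this
      rw [hsq]
      exact (Real.lt_sqrt (norm_nonneg _)).1 this)
    refine ⟨x, tendsto_iff_norm_sub_tendsto_zero.2 ?_⟩
    simpa [hnorm] using hx.sqrt
  exact ⟨V, i1, i2, hc, LinearEquiv.refl ℂ V, fun x y => rfl⟩

variable {H : Type v} [NormedAddCommGroup H] [NormedSpace ℂ H]

lemma IsHilbertScalarProduct.exists_norm_bounds {S : H →ₗ⋆[ℂ] H →ₗ[ℂ] ℂ}
    (hS : IsHilbertScalarProduct S) : ∃ a b : ℝ, 0 < a ∧ 0 < b ∧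
      ∀ x, a * ‖x‖ ≤ √(S x x).re ∧ √(S x x).re ≤ b * ‖x‖ := by
  obtain ⟨c, C, hc, hC, h⟩ := hS.induces_topology
  refine ⟨√c, √C, Real.sqrt_pos.2 hc, Real.sqrt_pos.2 hC, fun x => ⟨?_, ?_⟩⟩
  · rw [← Real.sqrt_sq (norm_nonneg x), ← Real.sqrt_mul hc.le]
    exact Real.sqrt_le_sqrt (h x).1
  · rw [← Real.sqrt_sq (norm_nonneg x), ← Real.sqrt_mul hC.le]
    exact Real.sqrt_le_sqrt (h x).2

lemma IsHilbertScalarProduct.exists_model {S : H →ₗ⋆[ℂ] H →ₗ[ℂ] ℂ}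
    (hS : IsHilbertScalarProduct S) :
    ∃ (K : Type v) (_ : NormedAddCommGroup K) (_ : InnerProductSpace ℂ K) (_ : CompleteSpace K)
      (e : H ≃L[ℂ] K), ∀ x y, inner ℂ (e x) (e y) = S x y := by
  obtain ⟨K, i1, i2, i3, e, he⟩ := hS.hilbert.exists_model hS.symm
  obtain ⟨a, b, ha, hb, hab⟩ := hS.exists_norm_bounds
  have hn : ∀ x, ‖e x‖ = √(S x x).re := fun x => by
    rw [← he, norm_eq_sqrt_re_inner (𝕜 := ℂ)]; rfl
  refine ⟨K, i1, i2, i3, e.toContinuousLinearEquivOfBounds b a⁻¹ (fun x => ?_) (fun y => ?_), he⟩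
  · rw [hn]; exact (hab x).2
  · have := (hab (e.symm y)).1
    rw [← hn, e.apply_symm_apply] at this
    rwa [inv_mul_eq_div, le_div_iff₀' ha]

lemma IsHilbertScalarProduct.exists_representative {S S' : H →ₗ⋆[ℂ] H →ₗ[ℂ] ℂ}
    (hS : IsHilbertScalarProduct S) (hS' : IsHilbertScalarProduct S') (x : H) :
    ∃ v, ∀ y, S x y = S' v y := by
  obtain ⟨hcs, -⟩ := schwarz_and_riesz S hS.symm hS.hilbert
  obtain ⟨-, hr⟩ := schwarz_and_riesz S' hS'.symm hS'.hilbert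
  obtain ⟨a, b, ha, hb, hab⟩ := hS.exists_norm_bounds
  obtain ⟨a', b', ha', hb', hab'⟩ := hS'.exists_norm_bounds
  refine hr (S x) (√(S x x).re * (b / a')) fun y => ?_
  calc ‖S x y‖ ≤ √(S x x).re * (b * ‖y‖) := (hcs x y).trans (by gcongr; exact (hab y).2)
    _ = √(S x x).re * (b / a') * (a' * ‖y‖) := by field_simp
    _ ≤ _ := by gcongr; exact (hab' y).1

/-- The form of a Krein space and an admissible scalar product are related by a Gram operator `g`
with inverse `f`. -/
lemma IsKreinSpace.exists_gram {B S : H →ₗ⋆[ℂ] H →ₗ[ℂ] ℂ} (hB : IsKreinSpace B)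
    (hS : IsHilbertScalarProduct S) :
    ∃ g f : H → H, (∀ x y, S (g x) y = B x y) ∧ ∀ x y, B (f x) y = S x y := by
  obtain ⟨J, hJJ, -, hJS⟩ := hB.exists_symmetry
  choose g hg using hJS.exists_representative hS
  choose f hf using hS.exists_representative hJS
  refine ⟨fun x => g (J x), fun x => J (f x), fun x y => ?_, fun x y => (hf x y).symm⟩
  rw [← hg, LinearMap.comp_apply, hJJ]

end Krein

/-- A map with a symmetry relation for the inner product is a bounded selfadjoint operator
(Hellinger–Toeplitz; linearity is automatic as well). -/
lemma exists_isSelfAdjoint_of_symmetric {K : Type*} [NormedAddCommGroup K]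
    [InnerProductSpace ℂ K] [CompleteSpace K] (t : K → K)
    (ht : ∀ x y, inner ℂ (t x) y = inner ℂ x (t y)) :
    ∃ T : K →L[ℂ] K, IsSelfAdjoint T ∧ ∀ x, T x = t x := by
  let T : K →ₗ[ℂ] K :=
    { toFun := t
      map_add' := fun x y => ext_inner_right ℂ fun z => by
        rw [ht, inner_add_left, inner_add_left, ht, ht]
      map_smul' := fun c x => ext_inner_right ℂ fun z => by
        rw [ht, inner_smul_left, RingHom.id_apply, inner_smul_left, ht] }
  have hT : T.IsSymmetric := ht
  exact ⟨⟨T, hT.continuous⟩,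
    ContinuousLinearMap.isSelfAdjoint_iff_isSymmetric.2 hT, fun x => rfl⟩

namespace Krein

variable {H : Type v} [NormedAddCommGroup H] [NormedSpace ℂ H]

lemma IsAdjoint.symm {S : H →ₗ⋆[ℂ] H →ₗ[ℂ] ℂ} (hs : S.IsSymm) {T T' : H →L[ℂ] H}
    (h : IsAdjoint S T T') : IsAdjoint S T' T := fun x y => by
  rw [← hs.eq, ← h, hs.eq]

/-! ### Coincidence of the two adjoints and resolvent growth -/

/-- The adjoint of `N` in the Krein space is also its adjoint for every admissible scalar product
for which `N` is normal. -/
theorem isAdjoint_adjoint_of_isNormalWrt {B : H →ₗ⋆[ℂ] H →ₗ[ℂ] ℂ} (hB : IsKreinSpace B)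
    {N : H →L[ℂ] H} (hN : IsKreinNormal hB N) {S : H →ₗ⋆[ℂ] H →ₗ[ℂ] ℂ}
    (hS : IsHilbertScalarProduct S) (hNS : IsNormalWrt S N)
    (hRe : HasRealSpectrum (realPart hB N)) (hIm : HasRealSpectrum (imagPart hB N)) :
    IsAdjoint S N (adjoint hB N) := by
  obtain ⟨N', hN', hcomm⟩ := hNS
  obtain ⟨K, _, _, _, e, he⟩ := hS.exists_model
  obtain ⟨g, f, hg, hf⟩ := hB.exists_gram hS
  have heB : ∀ x y, inner ℂ (e (g x)) y = B x (e.symm y) := fun x y => by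
    rw [← hg, ← he, e.apply_symm_apply]
  obtain ⟨G, hGsa, hG⟩ := exists_isSelfAdjoint_of_symmetric (fun x => e (g (e.symm x)))
    (fun x y => by rw [heB, ← inner_conj_symm, heB, hB.symm.eq])
  have hGB : ∀ x y, inner ℂ (G x) y = B (e.symm x) (e.symm y) := fun x y => by rw [hG, heB]
  have hGf : ∀ x, G (e (f (e.symm x))) = x := fun x => ext_inner_right ℂ fun y => by
    rw [hGB, e.symm_apply_apply, hf, ← he, e.apply_symm_apply, e.apply_symm_apply]
  have hGsym : ∀ x y, inner ℂ (G x) y = inner ℂ x (G y) :=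
    ContinuousLinearMap.isSelfAdjoint_iff_isSymmetric.1 hGsa
  obtain ⟨F, hFsa, hF⟩ := exists_isSelfAdjoint_of_symmetric (fun x => e (f (e.symm x)))
    (fun x y => by
      conv_lhs => rw [← hGf y]
      rw [← hGsym, hGf])
  have hGF : G * F = 1 := ContinuousLinearMap.ext fun x => by
    rw [mul_apply_eq_comp, hF, hGf, one_apply_eq_self]
  have hFG : F * G = 1 := by
    have := congrArg star hGF
    rwa [star_mul, hGsa.star_eq, hFsa.star_eq, star_one] at this
  let u : (K →L[ℂ] K)ˣ := ⟨G, F, hGF, hFG⟩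
  set φ := e.conjContinuousAlgEquiv with hφ
  set N₁ := adjoint hB N with hN₁
  have hφ' : ∀ (T : H →L[ℂ] H) (x : K), e.symm (φ T x) = T (e.symm x) := fun T x => by
    simp [hφ]
  have hinner : ∀ x y : K, inner ℂ x y = S (e.symm x) (e.symm y) := fun x y => by
    rw [← he, e.apply_symm_apply, e.apply_symm_apply]
  have hstar : star (φ N) = φ N' := by
    refine ((ContinuousLinearMap.eq_adjoint_iff _ _).2 fun x y => ?_).symm
    rw [hinner, hinner, hφ', hφ', hN'.symm hS.symm]
  have hnormal : IsStarNormal (φ N) := ⟨by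
    rw [hstar, Commute, SemiconjBy, ← map_mul, ← map_mul, hcomm]⟩
  have hm : φ N₁ = ↑u⁻¹ * star (φ N) * u := by
    have h1 : G * φ N₁ = star (φ N) * G := ContinuousLinearMap.ext fun y =>
      ext_inner_left ℂ fun x => by
        rw [mul_apply_eq_comp, mul_apply_eq_comp, ← hGsym, hGB, hφ',
          ← isAdjoint_adjoint hB N, ← hφ', ← hGB, hGsym, ContinuousLinearMap.star_eq_adjoint,
          ContinuousLinearMap.adjoint_inner_right]
    change _ = F * star (φ N) * G
    rw [mul_assoc, ← h1, ← mul_assoc, hFG, one_mul]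
  have hspec : ∀ T : H →L[ℂ] H, spectrum ℂ (φ T) = spectrum ℂ T := fun T =>
    AlgEquiv.spectrum_eq φ T
  have key : φ N₁ = star (φ N) := by
    rw [hm]
    refine hnormal.conj_star_eq_star u hGsa ?_ ?_ ?_
    · rw [← hm, Commute, SemiconjBy, ← map_mul, ← map_mul, hN]
    · intro z hz
      rw [← hm, ← map_add, hspec] at hz
      have : N + N₁ = (2 : ℂ) • realPart hB N := by
        rw [realPart, smul_smul, mul_one_div_cancel two_ne_zero, one_smul]
      rw [this] at hz
      obtain ⟨w, hw, rfl⟩ := spectrum.exists_mul_of_mem_smul two_ne_zero hz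
      simp [hRe w hw]
    · intro z hz
      rw [← hm, ← map_sub, hspec] at hz
      have : N - N₁ = (2 * Complex.I : ℂ) • imagPart hB N := by
        rw [imagPart, smul_smul, mul_one_div_cancel (by simp), one_smul]
      rw [this] at hz
      obtain ⟨w, hw, rfl⟩ := spectrum.exists_mul_of_mem_smul (by simp) hz
      simp [hIm w hw]
  have : N₁ = N' := φ.injective (key.trans hstar)
  rwa [this]

/-- Selfadjointness gives `|Im z| ‖x‖² = |Im ⟨x, (z - T) x⟩| ≤ ‖x‖ ‖(z - T) x‖` in the norm of `S`,
and that norm is equivalent to the given one. -/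
theorem IsSelfadjointWrt.hasResolventGrowth_one {S : H →ₗ⋆[ℂ] H →ₗ[ℂ] ℂ}
    (hS : IsHilbertScalarProduct S) {T : H →L[ℂ] H} (hT : IsSelfadjointWrt S T)
    (hr : HasRealSpectrum T) : HasResolventGrowth T 1 := by
  obtain ⟨a, b, ha, hb, hab⟩ := hS.exists_norm_bounds
  obtain ⟨hcs, -⟩ := schwarz_and_riesz S hS.symm hS.hilbert
  have him0 : ∀ {w : ℂ}, (starRingEnd ℂ) w = w → w.im = 0 := Complex.conj_eq_iff_im.1
  have key : ∀ (z : ℂ) (x : H),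
      |z.im| * √(S x x).re ≤ √(S (z • x - T x) (z • x - T x)).re := by
    intro z x
    have h1 : (S x (z • x - T x)).im = z.im * (S x x).re := by
      have e1 : (S x (T x)).im = 0 := him0 (by rw [hS.symm.eq, hT])
      have e2 : (S x x).im = 0 := him0 (hS.symm.eq x x)
      rw [map_sub, map_smul, Complex.sub_im, e1, smul_eq_mul, Complex.mul_im, e2]
      ring
    have h2 : |z.im| * √(S x x).re * √(S x x).re ≤
        √(S (z • x - T x) (z • x - T x)).re * √(S x x).re := by
      calc _ = |z.im * (S x x).re| := by
            rw [mul_assoc, Real.mul_self_sqrt (nonneg_of_pos hS.hilbert Submodule.mem_top),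
              abs_mul, abs_of_nonneg (nonneg_of_pos hS.hilbert Submodule.mem_top)]
        _ ≤ ‖S x (z • x - T x)‖ := by rw [← h1]; exact Complex.abs_im_le_norm _
        _ ≤ _ := (hcs _ _).trans_eq (mul_comm _ _)
    rcases (Real.sqrt_nonneg (S x x).re).eq_or_lt with h0 | h0
    · rw [← h0, mul_zero]; exact Real.sqrt_nonneg _
    · exact le_of_mul_le_mul_right h2 h0
  refine ⟨one_ne_zero, hr, 1, one_pos, b / a, by positivity, fun z hz _ => ?_⟩
  have hu : IsUnit (algebraMap ℂ (H →L[ℂ] H) z - T) := by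
    by_contra h
    rw [hr z h, abs_zero] at hz
    exact hz.false
  have hres : ∀ y, z • resolvent T z y - T (resolvent T z y) = y := fun y => by
    have := congrArg (fun R : H →L[ℂ] H => R y) (Ring.mul_inverse_cancel _ hu)
    simpa [resolvent, Algebra.algebraMap_eq_smul_one] using this
  rw [pow_one]
  refine ContinuousLinearMap.opNorm_le_bound _ (by positivity) fun y => ?_
  have h1 := key z (resolvent T z y)
  rw [hres] at h1
  have h2 : |z.im| * (a * ‖resolvent T z y‖) ≤ b * ‖y‖ :=
    (mul_le_mul_of_nonneg_left (hab _).1 hz.le).trans (h1.trans (hab y).2)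
  rw [div_div, div_mul_eq_mul_div, le_div_iff₀ (by positivity)]
  linarith

end Krein

theorem theorem4p4 {H : Type*} [NormedAddCommGroup H] [NormedSpace ℂ H]
    (B : H →ₗ⋆[ℂ] H →ₗ[ℂ] ℂ) (hB : Krein.IsKreinSpace B)
    (N : H →L[ℂ] H) (hN : Krein.IsKreinNormal hB N)
    (hsim : Krein.IsSimilarToNormal N)
    (hRe : Krein.HasRealSpectrum (Krein.realPart hB N))
    (hIm : Krein.HasRealSpectrum (Krein.imagPart hB N)) :
    (∃ S : H →ₗ⋆[ℂ] H →ₗ[ℂ] ℂ, Krein.IsHilbertScalarProduct S ∧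
      Krein.IsSelfadjointWrt S (Krein.realPart hB N) ∧
      Krein.IsSelfadjointWrt S (Krein.imagPart hB N)) ∧
    Krein.HasResolventGrowth (Krein.realPart hB N) 1 ∧
    Krein.HasResolventGrowth (Krein.imagPart hB N) 1 := by
  obtain ⟨S, hS, hNS⟩ := hsim
  have h := Krein.isAdjoint_adjoint_of_isNormalWrt hB hN hS hNS hRe hIm
  have h' := h.symm hS.symm
  have hR : Krein.IsSelfadjointWrt S (Krein.realPart hB N) := fun x y => by
    simp [Krein.realPart, h x y, h' x y, map_ofNat, add_comm]
  have hI : Krein.IsSelfadjointWrt S (Krein.imagPart hB N) := fun x y => by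
    simp [Krein.imagPart, h x y, h' x y, map_ofNat]
    ring
  exact ⟨⟨S, hS, hR, hI⟩, hR.hasResolventGrowth_one hS hRe, hI.hasResolventGrowth_one hS hIm⟩
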